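/- Let $\mathfrak H$ be a complex Hilbert space and let $S$ be a closed, densely defined symmetric operator in $\mathfrak H$ (symmetric: $\operatorname{Im}(Sf,f)=0$ for all $f\in\operatorname{dom}S$). For $\lambda\in\mathbb C\setminus\mathbb R$ put $\mathfrak M_\lambda=\operatorname{ran}(S-\lambda I)$, a closed linear subspace, and let $P_{\mathfrak M_\lambda}$ be the orthogonal projection onto it. Assume that both deficiency indices of $S$ are infinite, i.e. $\dim\mathfrak M_{-i}^{\perp}=\dim\mathfrak M_{i}^{\perp}=\infty$. Let $\operatorname{dom}S^2=\{f\in\operatorname{dom}S: Sf\in\operatorname{dom}S\}$. A linear manifold $\mathcal D\subseteq\operatorname{dom}S$ is a core of $S$ if the closure of $S\upharpoonright\mathcal D$ is $S$. For a linear manifold $\mathcal L\subseteq\mathfrak M_\lambda$ write $\mathfrak M_\lambda\ominus\mathcal L=\mathfrak M_\lambda\cap\mathcal L^\perp$. (1) The following are equivalent: (i) $\operatorname{dom}S^2$ is dense in $\mathfrak H$ but is not a core of $S$; (ii) for at least one $\lambda\in\mathbb C\setminus\mathbb R$, the linear manifold $\mathfrak M_\lambda\cap\operatorname{dom}S$ is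 different from $\{0\}$ and not dense in $\mathfrak M_\lambda$, and $$P_{\mathfrak M_\lambda}(\operatorname{dom}S^*)\cap\bigl(\mathfrak M_\lambda\ominus(\mathfrak M_\lambda\cap\operatorname{dom}S)\bigr)=\{0\};$$ (iii) the condition stated in (ii) holds for every $\lambda\in\mathbb C\setminus\mathbb R$. (2) The following are equivalent: (i) $\operatorname{dom}S^2$ is different from $\{0\}$ and not dense in $\mathfrak H$; (ii) for at least one $\lambda\in\mathbb C\setminus\mathbb R$, the linear manifold $\mathfrak M_\lambda\cap\operatorname{dom}S$ is different from $\{0\}$ and not dense in $\mathfrak M_\lambda$, and $$P_{\mathfrak M_\lambda}(\operatorname{dom}S^*)\cap\bigl(\mathfrak M_\lambda\ominus(\mathfrak M_\lambda\cap\operatorname{dom}S)\bigr)\neq\{0\};$$ (iii) the condition stated in (ii) holds for every $\lambda\in\mathbb C\setminus\mathbb R$. -/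

import Mathlib

open scoped InnerProductSpace LinearPMap ComplexConjugate

noncomputable section

namespace SymmSquare

variable {H : Type*} [NormedAddCommGroup H] [InnerProductSpace ℂ H]

/-- An unbounded operator `S` in a complex Hilbert space is symmetric (Hermitian) if
`Im (S f, f) = 0` for all `f` in its domain. -/
def IsSymmetric (S : H →ₗ.[ℂ] H) : Prop :=
  ∀ f : S.domain, (⟪S f, (f : H)⟫_ℂ).im = 0

/-- The domain of `S²`: all `f ∈ dom S` with `S f ∈ dom S`. -/
def squareDomain (S : H →ₗ.[ℂ] H) : Submodule ℂ H where
  carrier := {x | ∃ hx : x ∈ S.domain, S ⟨x, hx⟩ ∈ S.domain}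
  zero_mem' := ⟨S.domain.zero_mem, by
    have h : S ⟨0, S.domain.zero_mem⟩ = 0 := S.map_zero
    rw [h]; exact S.domain.zero_mem⟩
  add_mem' := by
    rintro x y ⟨hx, hSx⟩ ⟨hy, hSy⟩
    refine ⟨S.domain.add_mem hx hy, ?_⟩
    have h : S ⟨x + y, S.domain.add_mem hx hy⟩ = S ⟨x, hx⟩ + S ⟨y, hy⟩ :=
      S.map_add ⟨x, hx⟩ ⟨y, hy⟩
    rw [h]; exact S.domain.add_mem hSx hSy
  smul_mem' := by
    rintro c x ⟨hx, hSx⟩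
    refine ⟨S.domain.smul_mem c hx, ?_⟩
    have h : S ⟨c • x, S.domain.smul_mem c hx⟩ = c • S ⟨x, hx⟩ := S.map_smul c ⟨x, hx⟩
    rw [h]; exact S.domain.smul_mem c hSx

/-- The operator `S²`, `S² f = S (S f)` on its natural domain. -/
def square (S : H →ₗ.[ℂ] H) : H →ₗ.[ℂ] H where
  domain := squareDomain S
  toFun :=
    { toFun := fun x => S ⟨S ⟨x, x.2.1⟩, x.2.2⟩
      map_add' := fun x y => by
        rw [← S.map_add]
        congr 1
        exact Subtype.ext (S.map_add ⟨x, x.2.1⟩ ⟨y, y.2.1⟩)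
      map_smul' := fun c x => by
        rw [RingHom.id_apply, ← S.map_smul]
        congr 1
        exact Subtype.ext (S.map_smul c ⟨x, x.2.1⟩) }

/-- `M_z = ran (S - z I)`. -/
def ranSub (S : H →ₗ.[ℂ] H) (z : ℂ) : Submodule ℂ H :=
  LinearMap.range (S.toFun - z • S.domain.subtype)

/-- The deficiency subspace `N_z`, the orthogonal complement of `M_{conj z}`. -/
def deficiencySubspace (S : H →ₗ.[ℂ] H) (z : ℂ) : Submodule ℂ H :=
  (ranSub S (conj z))ᗮ

/-- Both deficiency indices of `S` are infinite. The dimension of `N_z` is constant on each of the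
open half-planes, so the indices `n₊` and `n₋` are the dimensions of `N_i` and `N_{-i}`. -/
def InfiniteDeficiency (S : H →ₗ.[ℂ] H) : Prop :=
  ¬ FiniteDimensional ℂ (deficiencySubspace S Complex.I) ∧
    ¬ FiniteDimensional ℂ (deficiencySubspace S (-Complex.I))

/-- The linear manifold `M_z ∩ dom S`. -/
def ranInterDomain (S : H →ₗ.[ℂ] H) (z : ℂ) : Submodule ℂ H :=
  ranSub S z ⊓ S.domain

/-- Every non-real `z` is a point of regular type of a symmetric operator. -/
theorem norm_le_of_isSymmetric {S : H →ₗ.[ℂ] H} (hS : IsSymmetric S) (z : ℂ) (f : S.domain) :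
    |z.im| * ‖(f : H)‖ ≤ ‖S f - z • (f : H)‖ := by
  have h1 : (⟪S f - z • (f : H), (f : H)⟫_ℂ).im = z.im * (‖(f : H)‖ * ‖(f : H)‖) := by
    have h0 : ⟪(f : H), (f : H)⟫_ℂ = ((‖(f : H)‖ * ‖(f : H)‖ : ℝ) : ℂ) := by
      rw [inner_self_eq_norm_sq_to_K, ← sq]
      norm_cast
    rw [inner_sub_left, inner_smul_left, h0, Complex.sub_im, hS f, Complex.im_mul_ofReal,
      Complex.conj_im]
    ring
  have h2 : |z.im| * ‖(f : H)‖ * ‖(f : H)‖ ≤ ‖S f - z • (f : H)‖ * ‖(f : H)‖ := by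
    calc |z.im| * ‖(f : H)‖ * ‖(f : H)‖ = |(⟪S f - z • (f : H), (f : H)⟫_ℂ).im| := by
          rw [h1, abs_mul, abs_mul_self, mul_assoc]
      _ ≤ ‖⟪S f - z • (f : H), (f : H)⟫_ℂ‖ := Complex.abs_im_le_norm _
      _ ≤ _ := norm_inner_le_norm _ _
  rcases (norm_nonneg (f : H)).eq_or_lt with h0 | h0
  · rw [← h0, mul_zero]; exact norm_nonneg _
  · exact le_of_mul_le_mul_right h2 h0

/-- For a closed symmetric operator, `M_z` is closed for every non-real `z`. -/
theorem isClosed_ranSub [CompleteSpace H] {S : H →ₗ.[ℂ] H} (hc : S.IsClosed)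
    (hS : IsSymmetric S) {z : ℂ} (hz : z.im ≠ 0) : IsClosed (ranSub S z : Set H) := by
  have hG : IsClosed (S.graph : Set (H × H)) := hc
  have : CompleteSpace S.graph := hG.completeSpace_coe
  let Φ : S.graph →L[ℂ] H :=
    ((ContinuousLinearMap.snd ℂ H H) - z • (ContinuousLinearMap.fst ℂ H H)).comp
      S.graph.subtypeL
  have hz0 : 0 < |z.im| := abs_pos.mpr hz
  have key : ∀ p : S.graph, ‖p‖ ≤ ((1 + (1 + ‖z‖) / |z.im|).toNNReal : ℝ) * ‖Φ p‖ := by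
    intro p
    obtain ⟨f, hf1, hf2⟩ := (LinearPMap.mem_graph_iff S).1 p.2
    have hΦ : Φ p = S f - z • (f : H) := by
      change (p : H × H).2 - z • (p : H × H).1 = _
      rw [hf1, hf2]
    have hb := norm_le_of_isSymmetric hS z f
    rw [← hΦ] at hb
    have hf : ‖(f : H)‖ ≤ ‖Φ p‖ / |z.im| := by
      rw [le_div_iff₀ hz0, mul_comm]; exact hb
    have hSf : ‖S f‖ ≤ ‖Φ p‖ + ‖z‖ * ‖(f : H)‖ := by
      calc ‖S f‖ = ‖Φ p + z • (f : H)‖ := by rw [hΦ, sub_add_cancel]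
        _ ≤ _ := (norm_add_le _ _).trans (by rw [norm_smul])
    have hzf : ‖z‖ * ‖(f : H)‖ ≤ ‖z‖ * (‖Φ p‖ / |z.im|) :=
      mul_le_mul_of_nonneg_left hf (norm_nonneg _)
    have hzn : 0 ≤ ‖z‖ * (‖Φ p‖ / |z.im|) := by positivity
    have hdn : 0 ≤ ‖Φ p‖ / |z.im| := by positivity
    have hpn : 0 ≤ ‖Φ p‖ := norm_nonneg _
    have hexp : (1 + (1 + ‖z‖) / |z.im|) * ‖Φ p‖
        = ‖Φ p‖ + ‖Φ p‖ / |z.im| + ‖z‖ * (‖Φ p‖ / |z.im|) := by ring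
    rw [Real.coe_toNNReal _ (by positivity), hexp]
    change ‖(p : H × H)‖ ≤ _
    rw [Prod.norm_def, ← hf1, ← hf2]
    exact max_le (by linarith) (by linarith)
  have hanti : AntilipschitzWith _ Φ := Φ.antilipschitz_of_bound key
  have hr := hanti.isClosed_range Φ.uniformContinuous
  convert hr using 1
  ext y
  constructor
  · rintro ⟨f, rfl⟩
    exact ⟨⟨((f : H), S f), S.mem_graph f⟩, rfl⟩
  · rintro ⟨p, rfl⟩
    obtain ⟨f, hf1, hf2⟩ := (LinearPMap.mem_graph_iff S).1 p.2
    refine ⟨f, ?_⟩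
    change S f - z • (f : H) = (p : H × H).2 - z • (p : H × H).1
    rw [hf1, hf2]

/-- The orthogonal projection of `H` onto `M_z`. The closure is only there to have the projection
defined for all `S` and `z`; `topologicalClosure_ranSub` says that it changes nothing for closed
symmetric `S` and non-real `z`. -/
def projRan [CompleteSpace H] (S : H →ₗ.[ℂ] H) (z : ℂ) : H →L[ℂ] H :=
  (ranSub S z).topologicalClosure.starProjection

theorem topologicalClosure_ranSub [CompleteSpace H] {S : H →ₗ.[ℂ] H} (hc : S.IsClosed)
    (hS : IsSymmetric S) {z : ℂ} (hz : z.im ≠ 0) :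
    (ranSub S z).topologicalClosure = ranSub S z :=
  (isClosed_ranSub hc hS hz).submodule_topologicalClosure_eq

/-- `P_{M_z}(dom S*) ∩ (M_z ⊖ (M_z ∩ dom S))`. -/
def projInter [CompleteSpace H] (S : H →ₗ.[ℂ] H) (z : ℂ) : Submodule ℂ H :=
  (S†).domain.map (projRan S z).toLinearMap ⊓ (ranSub S z ⊓ (ranInterDomain S z)ᗮ)

/-- `M_z ∩ dom S` is non-trivial and not dense in `M_z`. -/
def NontrivialNotDense (S : H →ₗ.[ℂ] H) (z : ℂ) : Prop :=
  ranInterDomain S z ≠ ⊥ ∧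
    ¬ ((ranSub S z : Set H) ⊆ closure (ranInterDomain S z : Set H))

end SymmSquare

end

/-!
For a non-real `z` the operator `S - z` is a bijection of `dom S` onto the closed subspace
`M_z = ran (S - z)` with bounded inverse `R : M_z → H`. Since `f ∈ dom S²` means
`(S - z) f ∈ M_z ∩ dom S`, the three properties of `dom S²` in the theorem are read off from
`M_z ∩ dom S`:

* `dom S² = {0}` if and only if `M_z ∩ dom S = {0}` (`ranInterDomain_eq_bot_iff`);
* `S - z` is a homeomorphism of `dom S` with the graph norm onto `M_z`, so `dom S²` is a core
  exactly when `M_z ∩ dom S` is dense in `M_z` (`hasCore_squareDomain_iff`);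
* the adjoint `R* : H → M_z` is injective with range `P(dom S*)`, because
  `P w = R* ((S* - z̄) w)` on `dom S*` and `R*` maps into `dom S*`. As `⟪f, g⟫ = ⟪(S - z) f, R* g⟫`,
  the vector `g` is orthogonal to `dom S²` if and only if `R* g` is orthogonal to `M_z ∩ dom S`. So
  `dom S²` is dense exactly when `P(dom S*) ∩ (M_z ⊖ (M_z ∩ dom S)) = {0}`
  (`projInter_eq_bot_iff`).

The left-hand sides do not depend on `z`, which is why one non-real `z` is as good as all of them.
-/

namespace SymmSquare

variable {H : Type*} [NormedAddCommGroup H] [InnerProductSpace ℂ H]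

theorem sub_smul_mem_ranSub (S : H →ₗ.[ℂ] H) (z : ℂ) (f : S.domain) :
    S f - z • (f : H) ∈ ranSub S z :=
  ⟨f, rfl⟩

theorem exists_of_mem_ranSub {S : H →ₗ.[ℂ] H} {z : ℂ} {h : H} (hh : h ∈ ranSub S z) :
    ∃ f : S.domain, S f - z • (f : H) = h :=
  hh

theorem sub_smul_mem_ranInterDomain_iff (S : H →ₗ.[ℂ] H) (z : ℂ) (f : S.domain) :
    S f - z • (f : H) ∈ ranInterDomain S z ↔ (f : H) ∈ squareDomain S := by
  have hz : z • (f : H) ∈ S.domain := S.domain.smul_mem z f.2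
  constructor
  · rintro ⟨-, h⟩
    exact ⟨f.2, by simpa using S.domain.add_mem h hz⟩
  · rintro ⟨_, h⟩
    exact ⟨sub_smul_mem_ranSub S z f, S.domain.sub_mem h hz⟩

theorem ranInterDomain_eq_bot_iff {S : H →ₗ.[ℂ] H} (hS : IsSymmetric S) {z : ℂ} (hz : z.im ≠ 0) :
    ranInterDomain S z = ⊥ ↔ squareDomain S = ⊥ := by
  simp only [Submodule.eq_bot_iff]
  constructor
  · rintro h f ⟨hf, hSf⟩
    have h0 := h _ ((sub_smul_mem_ranInterDomain_iff S z ⟨f, hf⟩).2 ⟨hf, hSf⟩)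
    have hb := norm_le_of_isSymmetric hS z ⟨f, hf⟩
    rw [h0, norm_zero] at hb
    exact norm_le_zero_iff.1 (nonpos_of_mul_nonpos_right hb (abs_pos.2 hz))
  · intro h y hy
    obtain ⟨f, rfl⟩ := exists_of_mem_ranSub hy.1
    have hf : f = 0 := Subtype.ext (h _ ((sub_smul_mem_ranInterDomain_iff S z f).1 hy))
    simp [hf]

/-- For a symmetric operator `S` and non-real `z`, the operator `S - z` has a bounded inverse on
`M_z`. -/
theorem exists_inverse {S : H →ₗ.[ℂ] H} (hS : IsSymmetric S) {z : ℂ} (hz : z.im ≠ 0) :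
    ∃ R : ranSub S z →L[ℂ] H,
      ∀ f : S.domain, R ⟨S f - z • (f : H), sub_smul_mem_ranSub S z f⟩ = f := by
  have hz0 : 0 < |z.im| := abs_pos.2 hz
  have hinj : Function.Injective (S.toFun - z • S.domain.subtype) := by
    refine (injective_iff_map_eq_zero _).2 fun f hf => ?_
    have hb := norm_le_of_isSymmetric hS z f
    rw [show S f - z • (f : H) = 0 from hf, norm_zero] at hb
    exact Subtype.ext (norm_le_zero_iff.1 (nonpos_of_mul_nonpos_right hb hz0))
  let e := LinearEquiv.ofInjective _ hinj
  have he (f : S.domain) : e.symm ⟨S f - z • (f : H), sub_smul_mem_ranSub S z f⟩ = f :=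
    e.symm_apply_apply f
  refine ⟨(S.domain.subtype ∘ₗ e.symm.toLinearMap).mkContinuous |z.im|⁻¹ ?_,
    fun f => congrArg Subtype.val (he f)⟩
  rintro ⟨_, f, rfl⟩
  change ‖((e.symm ⟨S f - z • (f : H), sub_smul_mem_ranSub S z f⟩ : S.domain) : H)‖ ≤
    |z.im|⁻¹ * ‖S f - z • (f : H)‖
  rw [he, inv_mul_eq_div, le_div_iff₀' hz0]
  exact norm_le_of_isSymmetric hS z f

theorem mem_graph_domRestrict_squareDomain_iff (S : H →ₗ.[ℂ] H) (p : H × H) :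
    p ∈ (S.domRestrict (squareDomain S)).graph ↔ p ∈ S.graph ∧ p.1 ∈ squareDomain S := by
  constructor
  · intro hp
    refine ⟨LinearPMap.le_graph_of_le LinearPMap.domRestrict_le hp, ?_⟩
    obtain ⟨f, hf, -⟩ := (LinearPMap.mem_graph_iff _).1 hp
    exact hf ▸ f.2.1
  · rintro ⟨hp, hsq⟩
    obtain ⟨f, hf1, hf2⟩ := (LinearPMap.mem_graph_iff _).1 hp
    refine (LinearPMap.mem_graph_iff _).2 ⟨⟨p.1, hsq, hf1 ▸ f.2⟩, rfl, ?_⟩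
    rw [← hf2]
    exact LinearPMap.domRestrict_apply hf1.symm

/-- The core property of `dom S²` is density of `M_z ∩ dom S` in `M_z`, since `(f, S f) ↦ (S - z) f`
is a homeomorphism of the graph of `S` onto `M_z` that takes the part over `dom S²` to
`M_z ∩ dom S`. -/
theorem hasCore_squareDomain_iff {S : H →ₗ.[ℂ] H} (hc : S.IsClosed) (hS : IsSymmetric S) {z : ℂ}
    (hz : z.im ≠ 0) :
    S.HasCore (squareDomain S) ↔ (ranSub S z : Set H) ⊆ closure (ranInterDomain S z : Set H) := by
  set T := S.domRestrict (squareDomain S)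
  have hT : T.IsClosable := hc.isClosable.leIsClosable LinearPMap.domRestrict_le
  constructor
  · rintro hcore _ ⟨f, rfl⟩
    have hf : ((f : H), S f) ∈ closure (T.graph : Set (H × H)) := by
      rw [← Submodule.topologicalClosure_coe, hT.graph_closure_eq_closure_graph, hcore.closure_eq]
      exact S.mem_graph f
    refine map_mem_closure (f := fun p : H × H => p.2 - z • p.1) (by fun_prop) hf ?_
    intro p hp
    obtain ⟨hpS, hsq⟩ := (mem_graph_domRestrict_squareDomain_iff S p).1 hp
    obtain ⟨f, hf1, hf2⟩ := (LinearPMap.mem_graph_iff _).1 hpS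
    rw [← hf1] at hsq
    have := (sub_smul_mem_ranInterDomain_iff S z f).2 hsq
    rwa [hf1, hf2] at this
  · intro hd
    obtain ⟨R, hR⟩ := exists_inverse hS hz
    refine ⟨fun f hf => hf.1, LinearPMap.eq_of_eq_graph ?_⟩
    rw [← hT.graph_closure_eq_closure_graph]
    refine le_antisymm (Submodule.topologicalClosure_minimal _
      (LinearPMap.le_graph_of_le LinearPMap.domRestrict_le) hc) ?_
    intro p hp
    obtain ⟨f, hf1, hf2⟩ := (LinearPMap.mem_graph_iff _).1 hp
    have hmem : (⟨S f - z • (f : H), sub_smul_mem_ranSub S z f⟩ : ranSub S z) ∈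
        closure ((↑) ⁻¹' (ranInterDomain S z : Set H)) := by
      rw [Topology.IsInducing.subtypeVal.closure_eq_preimage_closure_image]
      refine closure_mono (fun y hy => ?_) (hd (sub_smul_mem_ranSub S z f))
      exact ⟨⟨y, hy.1⟩, hy, rfl⟩
    -- `h ↦ (R h, h + z R h)` is the inverse of `(f, S f) ↦ (S - z) f`.
    have key := map_mem_closure (f := fun h : ranSub S z => (R h, (h : H) + z • R h))
      (t := (T.graph : Set (H × H))) (by fun_prop) hmem ?_
    · rw [hR, sub_add_cancel, hf1, hf2] at key
      exact key
    · rintro ⟨_, g, rfl⟩ hg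
      have hRg : R ⟨(S.toFun - z • S.domain.subtype) g, ⟨g, rfl⟩⟩ = g := hR g
      have hg' : S g - z • (g : H) ∈ ranInterDomain S z := hg
      have h2 : (S.toFun - z • S.domain.subtype) g + z • (g : H) = S g :=
        sub_add_cancel (S g) (z • (g : H))
      refine (mem_graph_domRestrict_squareDomain_iff S _).2 ?_
      simp only [hRg, h2]
      exact ⟨S.mem_graph g, (sub_smul_mem_ranInterDomain_iff S z g).1 hg'⟩

/-- A core of a densely defined operator is dense. -/
theorem dense_of_hasCore {S : H →ₗ.[ℂ] H} (hc : S.IsClosed) (hd : Dense (S.domain : Set H))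
    {D : Submodule ℂ H} (hD : S.HasCore D) : Dense (D : Set H) := by
  have hT : (S.domRestrict D).IsClosable := hc.isClosable.leIsClosable LinearPMap.domRestrict_le
  refine dense_closure.1 (hd.mono fun x hx => ?_)
  have hf : (x, S ⟨x, hx⟩) ∈ closure ((S.domRestrict D).graph : Set (H × H)) := by
    rw [← Submodule.topologicalClosure_coe, hT.graph_closure_eq_closure_graph, hD.closure_eq]
    exact S.mem_graph ⟨x, hx⟩
  refine map_mem_closure (f := Prod.fst) continuous_fst hf fun p hp => ?_
  obtain ⟨f, hf, -⟩ := (LinearPMap.mem_graph_iff _).1 hp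
  exact hf ▸ f.2.1

/-- With `R` the inverse of `S - z` on `M_z`, the map `R*` is a bijection of the orthogonal complement
of `dom S²` onto `P(dom S*) ∩ (M_z ⊖ (M_z ∩ dom S))`. -/
theorem projInter_eq_bot_iff [CompleteSpace H] {S : H →ₗ.[ℂ] H} (hc : S.IsClosed)
    (hd : Dense (S.domain : Set H)) (hS : IsSymmetric S) {z : ℂ} (hz : z.im ≠ 0) :
    projInter S z = ⊥ ↔ Dense (squareDomain S : Set H) := by
  obtain ⟨R, hR⟩ := exists_inverse hS hz
  have : CompleteSpace (ranSub S z) := (isClosed_ranSub hc hS hz).completeSpace_coe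
  have hRadj (f : S.domain) (g : H) : ⟪S f - z • (f : H), (R.adjoint g : H)⟫_ℂ = ⟪(f : H), g⟫_ℂ := by
    have h := R.adjoint_inner_right ⟨S f - z • (f : H), sub_smul_mem_ranSub S z f⟩ g
    rwa [hR, Submodule.coe_inner] at h
  have hcl := topologicalClosure_ranSub hc hS hz
  have hmem (g : H) : (R.adjoint g : H) ∈ (ranInterDomain S z)ᗮ ↔ g ∈ (squareDomain S)ᗮ := by
    simp only [Submodule.mem_orthogonal]
    constructor
    · rintro h f ⟨hf, hSf⟩
      rw [← hRadj ⟨f, hf⟩ g]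
      exact h _ ((sub_smul_mem_ranInterDomain_iff S z ⟨f, hf⟩).2 ⟨hf, hSf⟩)
    · intro h y hy
      obtain ⟨f, rfl⟩ := exists_of_mem_ranSub hy.1
      rw [hRadj]
      exact h _ ((sub_smul_mem_ranInterDomain_iff S z f).1 hy)
  -- The range of `R*` is `P(dom S*)`: the next two facts are the two inclusions.
  have hdom (g : H) : (R.adjoint g : H) ∈ S†.domain := by
    refine LinearPMap.mem_adjoint_domain_of_exists _ ⟨g + conj z • (R.adjoint g : H), fun f => ?_⟩
    have h := congrArg conj (hRadj f g)
    rw [inner_conj_symm, inner_conj_symm, inner_sub_right, inner_smul_right] at h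
    rw [inner_add_left, inner_smul_left, Complex.conj_conj, ← h, sub_add_cancel]
  have hproj (w : S†.domain) :
      projRan S z w = R.adjoint (S† w - conj z • (w : H)) := by
    refine Submodule.eq_starProjection_of_mem_orthogonal ?_ ?_
    · rw [hcl]
      exact Subtype.coe_prop _
    · rw [hcl, Submodule.mem_orthogonal]
      intro y hy
      obtain ⟨f, rfl⟩ := exists_of_mem_ranSub hy
      have h := congrArg conj (LinearPMap.adjoint_isFormalAdjoint hd w f)
      rw [inner_conj_symm, inner_conj_symm] at h
      rw [inner_sub_right, hRadj, inner_sub_left, inner_sub_right, inner_smul_left,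
        inner_smul_right, h, sub_self]
  rw [Submodule.dense_iff_topologicalClosure_eq_top, Submodule.topologicalClosure_eq_top_iff,
    Submodule.eq_bot_iff, Submodule.eq_bot_iff]
  constructor
  · intro h g hg
    have hmemM : (R.adjoint g : H) ∈ ranSub S z := Subtype.coe_prop _
    have h0 : (R.adjoint g : H) = 0 := by
      refine h _ ⟨⟨_, hdom g, ?_⟩, hmemM, (hmem g).2 hg⟩
      exact Submodule.starProjection_eq_self_iff.2 (by rwa [hcl])
    refine hd.eq_zero_of_inner_right ℂ fun f hf => ?_
    rw [← hRadj ⟨f, hf⟩ g, h0, inner_zero_right]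
  · rintro h _ ⟨⟨w, hw, rfl⟩, -, horth⟩
    have hw' := hproj ⟨w, hw⟩
    change projRan S z w ∈ (ranInterDomain S z)ᗮ at horth
    change projRan S z w = 0
    rw [hw', hmem] at horth
    rw [hw', h _ horth, map_zero, Submodule.coe_zero]

theorem nontrivialNotDense_iff {S : H →ₗ.[ℂ] H} (hc : S.IsClosed) (hS : IsSymmetric S) {z : ℂ}
    (hz : z.im ≠ 0) :
    NontrivialNotDense S z ↔ squareDomain S ≠ ⊥ ∧ ¬ S.HasCore (squareDomain S) := by
  rw [NontrivialNotDense, Ne, ranInterDomain_eq_bot_iff hS hz, hasCore_squareDomain_iff hc hS hz]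

theorem nontrivial_of_infiniteDeficiency {S : H →ₗ.[ℂ] H} (h : InfiniteDeficiency S) :
    Nontrivial H := by
  by_contra hH
  rw [not_nontrivial_iff_subsingleton] at hH
  exact h.1 inferInstance

/-- If for all non-real `z` the condition `q z` is equivalent to one and the same `p`, then `p`
holds if and only if `q z` does for some, or for every, non-real `z`. -/
theorem tfae_exists_forall_nonreal {p : Prop} {q : ℂ → Prop} (h : ∀ z : ℂ, z.im ≠ 0 → (q z ↔ p)) :
    List.TFAE [p, ∃ z : ℂ, z.im ≠ 0 ∧ q z, ∀ z : ℂ, z.im ≠ 0 → q z] := by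
  have hI : Complex.I.im ≠ 0 := by simp
  tfae_have 1 → 3 := fun hp z hz => (h z hz).2 hp
  tfae_have 3 → 2 := fun hq => ⟨Complex.I, hI, hq _ hI⟩
  tfae_have 2 → 1 := fun ⟨z, hz, hq⟩ => (h z hz).1 hq
  tfae_finish

end SymmSquare

theorem theorem9p1 {H : Type*} [NormedAddCommGroup H] [InnerProductSpace ℂ H] [CompleteSpace H]
    (S : H →ₗ.[ℂ] H) (hclosed : S.IsClosed) (hdense : Dense (S.domain : Set H))
    (hsymm : SymmSquare.IsSymmetric S) (hdef : SymmSquare.InfiniteDeficiency S) :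
    List.TFAE
      [Dense ((SymmSquare.square S).domain : Set H) ∧
          ¬ S.HasCore (SymmSquare.square S).domain,
        ∃ z : ℂ, z.im ≠ 0 ∧ SymmSquare.NontrivialNotDense S z ∧ SymmSquare.projInter S z = ⊥,
        ∀ z : ℂ, z.im ≠ 0 → SymmSquare.NontrivialNotDense S z ∧ SymmSquare.projInter S z = ⊥] ∧
    List.TFAE
      [(SymmSquare.square S).domain ≠ ⊥ ∧ ¬ Dense ((SymmSquare.square S).domain : Set H),
        ∃ z : ℂ, z.im ≠ 0 ∧ SymmSquare.NontrivialNotDense S z ∧ SymmSquare.projInter S z ≠ ⊥,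
        ∀ z : ℂ, z.im ≠ 0 → SymmSquare.NontrivialNotDense S z ∧ SymmSquare.projInter S z ≠ ⊥] := by
  have hDcore := SymmSquare.dense_of_hasCore (D := SymmSquare.squareDomain S) hclosed hdense
  refine ⟨SymmSquare.tfae_exists_forall_nonreal fun z hz => ?_,
    SymmSquare.tfae_exists_forall_nonreal fun z hz => ?_⟩
  · rw [SymmSquare.nontrivialNotDense_iff hclosed hsymm hz,
      SymmSquare.projInter_eq_bot_iff hclosed hdense hsymm hz]
    refine ⟨fun h => ⟨h.2, h.1.2⟩, fun ⟨hD, hcore⟩ => ⟨⟨fun h0 => ?_, hcore⟩, hD⟩⟩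
    -- In the zero space `{0}` would be dense; infinite deficiency indices rule that space out.
    have := SymmSquare.nontrivial_of_infiniteDeficiency hdef
    change Dense (SymmSquare.squareDomain S : Set H) at hD
    rw [Submodule.dense_iff_topologicalClosure_eq_top, h0,
      isClosed_singleton.submodule_topologicalClosure_eq] at hD
    exact bot_ne_top hD
  · rw [SymmSquare.nontrivialNotDense_iff hclosed hsymm hz, Ne, Ne,
      SymmSquare.projInter_eq_bot_iff hclosed hdense hsymm hz]
    -- A core is dense, so a `dom S²` that is not dense is not a core either.
    exact ⟨fun h => ⟨h.1.1, h.2⟩, fun h => ⟨⟨h.1, fun hcore => h.2 (hDcore hcore)⟩, h.2⟩⟩
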